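/- Let $\mathbb{S}=\bigcup_{n\ge 0}\{0,1\}^n$ be the set of finite binary strings (situations), $|s|$ the length of $s$, $\square$ the empty string, and let $\Omega=\{0,1\}^{\mathbb{N}}$ be the set of paths $\omega=(\omega_1,\omega_2,\dots)$, with $\omega_{1:n}=(\omega_1,\dots,\omega_n)$. An interval forecast is a non-empty closed interval $I\subseteq[0,1]$. A forecasting system is a map $\varphi$ that assigns an interval forecast $\varphi(s)=[\underline\varphi(s),\overline\varphi(s)]$ to every $s\in\mathbb{S}$; an interval forecast $I$ is identified with the constant (stationary) forecasting system $s\mapsto I$. The system $\varphi$ is precise if $\underline\varphi=\overline\varphi$, and temporal if $\varphi(s)=\varphi(t)$ whenever $|s|=|t|$. A rational map $q$ on a countable set of finite objects is recursive if $q=(-1)^c a/b$ for total recursive maps $a,b,c$ into $\mathbb{N}_0$ with $b$ nowhere $0$. A real map $r$ is lower semicomputable if there is a recursive rational map $q$ with $q(d,n)\le q(d,n+1)$ and $\lim_{m\to\infty} q(d,m)=r(d)$ for all $d,n$; it is computable if both $r$ and $-r$ are lower semicomputable. The system $\varphi$ is computable if $\underline\varphi$ and $\overline\varphi$ are. A test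 supermartingale for $\varphi$ is a map $T\colon\mathbb{S}\to[0,\infty)$ with $T(\square)=1$ and $p\,T(s1)+(1-p)\,T(s0)\le T(s)$ for all $s\in\mathbb{S}$ and $p\in\varphi(s)$. It is generated by $D\colon\mathbb{S}\times\{0,1\}\to[0,\infty)$ if $T(x_1,\dots,x_n)=\prod_{k=0}^{n-1}D((x_1,\dots,x_k),x_{k+1})$ always. It is unbounded on $\omega$ if $\limsup_{n\to\infty} T(\omega_{1:n})=\infty$, and computably unbounded on $\omega$ if $\limsup_{n\to\infty}[T(\omega_{1:n})-\tau(n)]\ge 0$ for some computable, non-decreasing, unbounded $\tau\colon\mathbb{N}_0\to[0,\infty)$. A path $\omega$ is - ML-random for $\varphi$ if no lower semicomputable test supermartingale for $\varphi$ is unbounded on $\omega$; - wML-random for $\varphi$ if no test supermartingale for $\varphi$ that is generated by a lower semicomputable $D$ is unbounded on $\omega$; - C-random for $\varphi$ if no computable test supermartingale for $\varphi$ is unbounded on $\omega$; - S-random for $\varphi$ if no computable test supermartingale for $\varphi$ is computably unbounded on $\omega$; - CH-random for $\varphi$ if for every recursive $S\colon\mathbb{S}\to\{0,1\}$ with $\sum_{k=0}^{n-1}S(\omega_{1:k})\to\infty$,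 $$\liminf_{n\to\infty}\frac{\sum_{k=0}^{n-1}S(\omega_{1:k})[\omega_{k+1}-\underline\varphi(\omega_{1:k})]}{\sum_{k=0}^{n-1}S(\omega_{1:k})}\ge 0\quad\text{and}\quad\limsup_{n\to\infty}\frac{\sum_{k=0}^{n-1}S(\omega_{1:k})[\omega_{k+1}-\overline\varphi(\omega_{1:k})]}{\sum_{k=0}^{n-1}S(\omega_{1:k})}\le 0;$$ - wCH-random for $\varphi$ if the same holds for every such $S$ for which $S(s)$ depends only on $|s|$. For each notion $\mathrm{R}$, let $I_{\mathrm{R}}(\omega)$ be the intersection of all interval forecasts $I$ for which $\omega$ is $\mathrm{R}$-random. **Theorem.** Let $\mathrm{R}\in\{\mathrm{ML},\mathrm{wML},\mathrm{C},\mathrm{S},\mathrm{CH},\mathrm{wCH}\}$, and let $\omega\in\Omega$ be $\mathrm{R}$-random for a computable, precise and temporal forecasting system $\varphi$. Then $$I_{\mathrm{R}}(\omega)=I_{\mathrm{wCH}}(\omega)=\Big[\liminf_{n\to\infty}\underline\varphi(\omega_{1:n}),\ \limsup_{n\to\infty}\overline\varphi(\omega_{1:n})\Big],$$ where $\underline\varphi=\overline\varphi=\varphi$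 since $\varphi$ is precise. -/

import Mathlib

open Filter Topology

noncomputable section

namespace ImpreciseRandomness

/-! ### Situations, paths, interval forecasts and forecasting systems -/

/-- A situation: a finite binary string. The sample space `{0, 1}` is `Bool`
(`true` is `1`, `false` is `0`), the empty string is the initial situation. -/
abbrev Situation := List Bool

/-- A path `(x₁, x₂, …)`; the entry `ω k` is the `(k + 1)`-st outcome. -/
abbrev Path := ℕ → Bool

/-- The outcome as a real number. -/
def bit (x : Bool) : ℝ := if x then 1 else 0

/-- The initial segment of length `n` of a path. -/
def Path.initSeg (ω : Path) (n : ℕ) : Situation := (List.range n).map ω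

/-- A non-empty closed subinterval `[lo, hi]` of `[0, 1]`. -/
structure IntervalForecast where
  lo : ℝ
  hi : ℝ
  zero_le : 0 ≤ lo
  lo_le_hi : lo ≤ hi
  le_one : hi ≤ 1

/-- The set of probabilities in the interval forecast. -/
def IntervalForecast.toSet (I : IntervalForecast) : Set ℝ := Set.Icc I.lo I.hi

abbrev ForecastingSystem := Situation → IntervalForecast

/-- The stationary forecasting system with value `I`. -/
def stationary (I : IntervalForecast) : ForecastingSystem := fun _ => I

def ForecastingSystem.Precise (φ : ForecastingSystem) : Prop :=
  ∀ s, (φ s).lo = (φ s).hi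

def ForecastingSystem.Temporal (φ : ForecastingSystem) : Prop :=
  ∀ s t : Situation, s.length = t.length → φ s = φ t

/-! ### Computability of rational and real maps -/

section Computability

variable {D : Type} [Primcodable D]

/-- A recursive rational map. -/
def RecursiveRat (q : D → ℚ) : Prop :=
  ∃ a b c : D → ℕ, Computable a ∧ Computable b ∧ Computable c ∧
    ∀ d, b d ≠ 0 ∧ q d = (-1) ^ c d * ((a d : ℚ) / (b d : ℚ))

def LowerSemicomputable (r : D → ℝ) : Prop :=
  ∃ q : D × ℕ → ℚ, RecursiveRat q ∧
    ∀ d, (∀ n, q (d, n) ≤ q (d, n + 1)) ∧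
      Tendsto (fun m => (q (d, m) : ℝ)) atTop (𝓝 (r d))

def UpperSemicomputable (r : D → ℝ) : Prop :=
  LowerSemicomputable fun d => -r d

/-- A computable real map: both lower and upper semicomputable. -/
def ComputableReal (r : D → ℝ) : Prop :=
  LowerSemicomputable r ∧ UpperSemicomputable r

end Computability

def ForecastingSystem.IsComputable (φ : ForecastingSystem) : Prop :=
  ComputableReal (fun s => (φ s).lo) ∧ ComputableReal (fun s => (φ s).hi)

/-! ### Test supermartingales -/

/-- The expectation of the gamble `f` under the probability `p` of the outcome `1`. -/
def expectation (p : ℝ) (f : Bool → ℝ) : ℝ := p * f true + (1 - p) * f false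

/-- The gamble `f` is allowable for `I`: its largest expectation over `I` is non-positive. -/
def Allowable (I : IntervalForecast) (f : Bool → ℝ) : Prop :=
  ∀ p ∈ I.toSet, expectation p f ≤ 0

/-- The process difference of `F`. -/
def processDiff (F : Situation → ℝ) (s : Situation) (x : Bool) : ℝ :=
  F (s ++ [x]) - F s

def IsSupermartingale (φ : ForecastingSystem) (M : Situation → ℝ) : Prop :=
  ∀ s, Allowable (φ s) (processDiff M s)

/-- A test supermartingale: a non-negative supermartingale with initial value one. -/
def IsTestSupermartingale (φ : ForecastingSystem) (T : Situation → ℝ) : Prop :=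
  IsSupermartingale φ T ∧ (∀ s, 0 ≤ T s) ∧ T [] = 1

/-- The process generated by a multiplier process `D`: the value at `(x₁, …, xₙ)` is the product
of the numbers `D (x₁, …, xₖ) xₖ₊₁` over `0 ≤ k < n`. -/
def generated (D : Situation → Bool → ℝ) (s : Situation) : ℝ :=
  ∏ k : Fin s.length, D (s.take k) (s.get k)

/-- The test supermartingales that define Martin-Löf randomness. -/
def mlTests (φ : ForecastingSystem) : Set (Situation → ℝ) :=
  {T | IsTestSupermartingale φ T ∧ LowerSemicomputable T}

/-- The test supermartingales that define weak Martin-Löf randomness: those that are generated by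
a lower semicomputable (non-negative) multiplier process. -/
def wmlTests (φ : ForecastingSystem) : Set (Situation → ℝ) :=
  {T | IsTestSupermartingale φ T ∧ ∃ D : Situation → Bool → ℝ,
    (∀ s x, 0 ≤ D s x) ∧
    LowerSemicomputable (fun d : Situation × Bool => D d.1 d.2) ∧ T = generated D}

/-- The test supermartingales that define computable and Schnorr randomness. -/
def compTests (φ : ForecastingSystem) : Set (Situation → ℝ) :=
  {T | IsTestSupermartingale φ T ∧ ComputableReal T}

/-- `limsup T(x₁, …, xₙ) = ∞` along the path. -/
def UnboundedOn (T : Situation → ℝ) (ω : Path) : Prop :=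
  limsup (fun n => ((T (ω.initSeg n) : ℝ) : EReal)) atTop = ⊤

/-- A real growth function: computable, non-negative, non-decreasing and unbounded. -/
def IsGrowthFunction (τ : ℕ → ℝ) : Prop :=
  ComputableReal τ ∧ (∀ n, 0 ≤ τ n) ∧ Monotone τ ∧ Tendsto τ atTop atTop

def ComputablyUnboundedOn (T : Situation → ℝ) (ω : Path) : Prop :=
  ∃ τ : ℕ → ℝ, IsGrowthFunction τ ∧
    0 ≤ limsup (fun n => ((T (ω.initSeg n) - τ n : ℝ) : EReal)) atTop

/-! ### Selection processes and the frequency conditions -/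

/-- A selection process; it selects the next outcome in `s` if its value is `1` (`true`). -/
abbrev SelectionProcess := Situation → Bool

def SelectionProcess.Temporal (S : SelectionProcess) : Prop :=
  ∀ s t : Situation, s.length = t.length → S s = S t

/-- The number of selected outcomes among the first `n` ones. -/
def selectionCount (S : SelectionProcess) (ω : Path) (n : ℕ) : ℝ :=
  ∑ k ∈ Finset.range n, bit (S (ω.initSeg k))

/-- The average over the selected outcomes among the first `n` ones of the difference between the
outcome and the forecast `f` (`0` by convention while nothing has been selected). -/
def selectedAverage (S : SelectionProcess) (f : Situation → ℝ) (ω : Path) (n : ℕ) : ℝ :=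
  (∑ k ∈ Finset.range n, bit (S (ω.initSeg k)) * (bit (ω k) - f (ω.initSeg k))) /
    selectionCount S ω n

/-- The frequency condition for a single selection process. -/
def FrequencyCondition (φ : ForecastingSystem) (ω : Path) (S : SelectionProcess) : Prop :=
  Tendsto (selectionCount S ω) atTop atTop →
    0 ≤ liminf (selectedAverage S (fun s => (φ s).lo) ω) atTop ∧
    limsup (selectedAverage S (fun s => (φ s).hi) ω) atTop ≤ 0

/-! ### The six notions of randomness and the smallest interval forecasts -/

/-- Martin-Löf, weak Martin-Löf, computable, Schnorr, Church and weak Church randomness. -/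
inductive Notion
  | ML
  | wML
  | C
  | S
  | CH
  | wCH

/-- `IsRandom R φ ω`: the path `ω` is `R`-random for the forecasting system `φ`. -/
def IsRandom : Notion → ForecastingSystem → Path → Prop
  | .ML, φ, ω => ∀ T ∈ mlTests φ, ¬ UnboundedOn T ω
  | .wML, φ, ω => ∀ T ∈ wmlTests φ, ¬ UnboundedOn T ω
  | .C, φ, ω => ∀ T ∈ compTests φ, ¬ UnboundedOn T ω
  | .S, φ, ω => ∀ T ∈ compTests φ, ¬ ComputablyUnboundedOn T ω
  | .CH, φ, ω => ∀ S : SelectionProcess, Computable S → FrequencyCondition φ ω S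
  | .wCH, φ, ω => ∀ S : SelectionProcess, Computable S → S.Temporal → FrequencyCondition φ ω S

/-- The interval forecasts for which `ω` is `R`-random. -/
def randomForecasts (R : Notion) (ω : Path) : Set IntervalForecast :=
  {I | IsRandom R (stationary I) ω}

/-- `I_R(ω)`: the intersection of all interval forecasts for which `ω` is `R`-random. -/
def smallestForecast (R : Notion) (ω : Path) : Set ℝ :=
  ⋂ I ∈ randomForecasts R ω, I.toSet

/-- `I_φ(ω)`: from the inferior limit of the lower forecasts along `ω` to the superior limit of the
upper forecasts along `ω`. -/
def limitForecast (φ : ForecastingSystem) (ω : Path) : Set ℝ :=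
  Set.Icc (liminf (fun n => (φ (ω.initSeg n)).lo) atTop)
    (limsup (fun n => (φ (ω.initSeg n)).hi) atTop)

end ImpreciseRandomness

end

/-!
The smallest forecast lies inside the limit interval by monotonicity. If `c` is smaller than the
inferior limit of the forecasts then, `φ` being temporal, all forecasts from some length `N` on lie
in `J = [max c 0, 1]`, and a path that is random for `φ` is random for the stationary forecast `J`
(`IsRandom.stationary_of_eventually_le`). For the frequency notions the first `N` outcomes do not
affect the averages. For the notions based on tests, `J` contains some `p` in `(0, 1)`, so a
supermartingale for `J` grows in one step by a bounded factor only; dividing it by that factor at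
each of the first `N` steps (`damped`) gives a test for `φ`, as large up to a constant, in the same
computability class.

Conversely, let the path be random both for `φ` and for a stationary `I`, with the inferior limit of
the forecasts below `I.lo`. By the same monotonicity, `I` may be replaced by `[b, 1]` with `b`
rational and smaller than `I.lo`, hence computable. Randomness of any of the six kinds for a
computable system implies weak Church randomness (`IsRandom.wCH`). Since `φ` is computable and
temporal, a recursive function of the length selects infinitely many situations in which `φ` lies
below `b` by a fixed margin; here precision of `φ` is used, since the selection has to see small
upper forecasts where it is the lower ones that are known to be small. Along this selection the
outcomes would have an asymptotic average below `b` by weak Church randomness for `φ`, and not below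
`b` by weak Church randomness for `[b, 1]` (`not_isRandom_wCH_of_gap`). The upper bounds are treated
symmetrically.

The implication `IsRandom.wCH` rests on one test for all four test notions at once. If the frequency
condition fails for a temporal selection, the forecasts are replaced by multiples of `1 / K`, found
by unbounded search (`ComputableReal.exists_approx`), that lie on the safe side of them; staking a
small fixed fraction of the capital on each selected outcome then multiplies natural numbers over a
fixed denominator, and the capital is infinitely often exponential in the number of selected
outcomes (`exists_test_of_gamble`). This number depends on the length only, so it provides the
computable growth function that Schnorr randomness asks for.
-/

namespace ImpreciseRandomness

/-! ### Computability of maps into the natural numbers -/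

section NatComputability

variable {D : Type} [Primcodable D]

theorem computable_add {f g : D → ℕ} (hf : Computable f) (hg : Computable g) :
    Computable fun d => f d + g d :=
  Primrec.nat_add.to_comp.comp hf hg

theorem computable_sub {f g : D → ℕ} (hf : Computable f) (hg : Computable g) :
    Computable fun d => f d - g d :=
  Primrec.nat_sub.to_comp.comp hf hg

theorem computable_mul {f g : D → ℕ} (hf : Computable f) (hg : Computable g) :
    Computable fun d => f d * g d :=
  Primrec.nat_mul.to_comp.comp hf hg

theorem computable_decide_lt {f g : D → ℕ} (hf : Computable f) (hg : Computable g) :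
    Computable fun d => decide (f d < g d) :=
  Primrec.nat_lt.decide.to_comp.comp hf hg

theorem computable_ite {c : D → Bool} {f g : D → ℕ} (hc : Computable c) (hf : Computable f)
    (hg : Computable g) : Computable fun d => if c d = true then f d else g d :=
  (Computable.cond hc hf hg).of_eq fun d => by cases c d <;> rfl

theorem computable_prod_range {f : D → ℕ} {g : D → ℕ → ℕ} (hf : Computable f)
    (hg : Computable₂ g) : Computable fun d => ∏ k ∈ Finset.range (f d), g d k := by
  refine (Computable.nat_rec (σ := ℕ) (h := fun d p => p.2 * g d p.1) hf (Computable.const 1)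
    (computable_mul (Computable.snd.comp Computable.snd)
      (hg.comp Computable.fst (Computable.fst.comp Computable.snd)))).of_eq fun d => ?_
  induction f d with
  | zero => simp
  | succ n ih => rw [Finset.prod_range_succ, ← ih]

theorem computable_sum_range {f : D → ℕ} {g : D → ℕ → ℕ} (hf : Computable f)
    (hg : Computable₂ g) : Computable fun d => ∑ k ∈ Finset.range (f d), g d k := by
  refine (Computable.nat_rec (σ := ℕ) (h := fun d p => p.2 + g d p.1) hf (Computable.const 0)
    (computable_add (Computable.snd.comp Computable.snd)
      (hg.comp Computable.fst (Computable.fst.comp Computable.snd)))).of_eq fun d => ?_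
  induction f d with
  | zero => simp
  | succ n ih => rw [Finset.sum_range_succ, ← ih]

theorem computable_const_pow {f : D → ℕ} (B : ℕ) (hf : Computable f) :
    Computable fun d => B ^ f d :=
  (computable_prod_range hf (g := fun _ _ => B) (Computable.const B)).of_eq fun d => by simp

/-- Unbounded search: a computable predicate that always has a witness has a computable choice of
witnesses. -/
theorem exists_computable_witness {p : D → ℕ → Bool} (hp : Computable₂ p)
    (h : ∀ d, ∃ n, p d n = true) : ∃ g : D → ℕ, Computable g ∧ ∀ d, p d (g d) = true := by
  have key : ∀ d, ∃ n, n ∈ Nat.rfind fun n => Part.some (p d n) := fun d =>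
    let ⟨m, hm⟩ := h d
    let ⟨n, hn, _⟩ := Nat.rfind_min' (p := p d) hm
    ⟨n, hn⟩
  choose g hg using key
  refine ⟨g, (Partrec.rfind (p := fun d n => Part.some (p d n)) hp.partrec₂).of_eq_tot hg,
    fun d => ?_⟩
  simpa using Nat.rfind_spec (hg d)

end NatComputability

/-! ### Recursive rational maps and computable real maps -/

section RealComputability

variable {D : Type} [Primcodable D]

theorem RecursiveRat.comp {E : Type} [Primcodable E] {q : D → ℚ} (hq : RecursiveRat q) {f : E → D}
    (hf : Computable f) : RecursiveRat fun e => q (f e) := by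
  obtain ⟨a, b, c, ha, hb, hc, h⟩ := hq
  exact ⟨_, _, _, ha.comp hf, hb.comp hf, hc.comp hf, fun e => h (f e)⟩

theorem RecursiveRat.neg {q : D → ℚ} (hq : RecursiveRat q) : RecursiveRat fun d => -q d := by
  obtain ⟨a, b, c, ha, hb, hc, h⟩ := hq
  refine ⟨a, b, fun d => c d + 1, ha, hb, computable_add hc (Computable.const 1),
    fun d => ⟨(h d).1, ?_⟩⟩
  simp only [(h d).2]
  ring

theorem RecursiveRat.div_nat {q : D → ℚ} (hq : RecursiveRat q) {g : D → ℕ} (hg : Computable g)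
    (hg0 : ∀ d, g d ≠ 0) : RecursiveRat fun d => q d / g d := by
  obtain ⟨a, b, c, ha, hb, hc, h⟩ := hq
  refine ⟨a, fun d => b d * g d, c, ha, computable_mul hb hg, hc,
    fun d => ⟨mul_ne_zero (h d).1 (hg0 d), ?_⟩⟩
  simp only [(h d).2]
  push_cast
  rw [mul_div_assoc, div_div]

theorem recursiveRat_natCast {f : D → ℕ} (hf : Computable f) : RecursiveRat fun d => (f d : ℚ) :=
  ⟨f, fun _ => 1, fun _ => 0, hf, Computable.const 1, Computable.const 0, fun d => by simp⟩

theorem RecursiveRat.lowerSemicomputable {q : D → ℚ} (hq : RecursiveRat q) :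
    LowerSemicomputable fun d => (q d : ℝ) :=
  ⟨fun p => q p.1, hq.comp Computable.fst, fun _ => ⟨fun _ => le_rfl, tendsto_const_nhds⟩⟩

theorem RecursiveRat.computableReal {q : D → ℚ} (hq : RecursiveRat q) :
    ComputableReal fun d => (q d : ℝ) :=
  ⟨hq.lowerSemicomputable, by simpa [UpperSemicomputable] using hq.neg.lowerSemicomputable⟩

theorem computableReal_natCast_div {f g : D → ℕ} (hf : Computable f) (hg : Computable g)
    (hg0 : ∀ d, g d ≠ 0) : ComputableReal fun d => (f d : ℝ) / g d := by
  simpa using ((recursiveRat_natCast hf).div_nat hg hg0).computableReal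

theorem LowerSemicomputable.div_nat {r : D → ℝ} (hr : LowerSemicomputable r) {g : D → ℕ}
    (hg : Computable g) (hg0 : ∀ d, g d ≠ 0) : LowerSemicomputable fun d => r d / g d := by
  obtain ⟨q, hq, h⟩ := hr
  refine ⟨fun p => q p / g p.1, hq.div_nat (hg.comp Computable.fst) fun p => hg0 p.1,
    fun d => ⟨fun n => ?_, ?_⟩⟩
  · exact div_le_div_of_nonneg_right ((h d).1 n) (by positivity)
  · simpa using (h d).2.div_const (g d : ℝ)

theorem ComputableReal.div_nat {r : D → ℝ} (hr : ComputableReal r) {g : D → ℕ}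
    (hg : Computable g) (hg0 : ∀ d, g d ≠ 0) : ComputableReal fun d => r d / g d :=
  ⟨hr.1.div_nat hg hg0, by simpa [UpperSemicomputable, neg_div] using hr.2.div_nat hg hg0⟩

theorem RecursiveRat.computable_decide {q : D → ℚ} (hq : RecursiveRat q) {u v : D → ℕ}
    (hu : Computable u) (hv : Computable v) (K : ℕ) :
    Computable fun d => decide ((v d : ℚ) < q d * K + u d) := by
  obtain ⟨a, b, c, ha, hb, hc, h⟩ := hq
  have haK := computable_mul ha (Computable.const K)
  have hub := computable_mul hu hb
  have hvb := computable_mul hv hb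
  -- Multiplying by the denominator reduces the comparison to one between natural numbers.
  refine (Computable.cond (Computable.nat_bodd.comp hc)
    (computable_decide_lt (computable_add hvb haK) hub)
    (computable_decide_lt hvb (computable_add haK hub))).of_eq fun d => ?_
  have hb0 : (0 : ℚ) < b d := by exact_mod_cast Nat.pos_of_ne_zero (h d).1
  rw [(h d).2]
  rcases hcd : (c d).bodd with _ | _
  · have he : Even (c d) := by
      rw [Nat.even_iff, Nat.mod_two_of_bodd, hcd]; rfl
    rw [cond_false, decide_eq_decide, he.neg_one_pow]
    rw [← Nat.cast_lt (α := ℚ)]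
    push_cast
    have : 1 * ((a d : ℚ) / b d) * K + u d = (a d * K + u d * b d) / b d := by field_simp
    rw [this, lt_div_iff₀ hb0]
  · have he : Odd (c d) := by
      rw [Nat.odd_iff, Nat.mod_two_of_bodd, hcd]; rfl
    rw [cond_true, decide_eq_decide, he.neg_one_pow]
    rw [← Nat.cast_lt (α := ℚ)]
    push_cast
    have : (-1 * ((a d : ℚ) / b d) * K + u d) = (u d * b d - a d * K) / b d := by
      field_simp; ring
    rw [this, lt_div_iff₀ hb0]
    constructor <;> intro h <;> linarith

/-- A non-negative computable real map can be approximated from above by a computable map with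
values in the multiples of `1 / K`. The approximation is found by dovetailing: a numerator `k` is
accepted once the lower approximations of `r` and of `-r` certify that
`(k - 2) / K < r < k / K`. -/
theorem ComputableReal.exists_approx {r : D → ℝ} (hr : ComputableReal r) (hr0 : ∀ d, 0 ≤ r d)
    (K : ℕ) : ∃ h : D → ℕ, Computable h ∧ ∀ d, r d * K ≤ h d ∧ h d ≤ r d * K + 2 := by
  obtain ⟨⟨q₁, hq₁, h₁⟩, ⟨q₂, hq₂, h₂⟩⟩ := hr
  have hmono₁ : ∀ d m, (q₁ (d, m) : ℝ) ≤ r d := fun d m =>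
    Monotone.ge_of_tendsto (f := fun m => (q₁ (d, m) : ℝ))
      (monotone_nat_of_le_succ fun n => by exact_mod_cast (h₁ d).1 n) (h₁ d).2 m
  have hmono₂ : ∀ d m, (q₂ (d, m) : ℝ) ≤ -r d := fun d m =>
    Monotone.ge_of_tendsto (f := fun m => (q₂ (d, m) : ℝ))
      (monotone_nat_of_le_succ fun n => by exact_mod_cast (h₂ d).1 n) (h₂ d).2 m
  let p : D → ℕ → Bool := fun d n =>
    decide (((n.unpair.1 : ℕ) : ℚ) < q₁ (d, n.unpair.2) * K + (2 : ℕ)) &&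
      decide (((0 : ℕ) : ℚ) < q₂ (d, n.unpair.2) * K + (n.unpair.1 : ℕ))
  have hun : Computable fun x : D × ℕ => x.2.unpair := Computable.unpair.comp Computable.snd
  have hk : Computable fun x : D × ℕ => x.2.unpair.1 := Computable.fst.comp hun
  have hdm : Computable fun x : D × ℕ => (x.1, x.2.unpair.2) :=
    Computable.pair Computable.fst (Computable.snd.comp hun)
  have hp : Computable₂ p :=
    Primrec.and.to_comp.comp
      ((hq₁.comp hdm).computable_decide (Computable.const 2) hk K)
      ((hq₂.comp hdm).computable_decide hk (Computable.const 0) K)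
  obtain ⟨g, hg, hpg⟩ := exists_computable_witness hp fun d => by
    let k : ℕ := ⌊r d * K⌋₊ + 1
    have hk1 : (k : ℝ) < r d * K + 2 := by
      have := Nat.floor_le (mul_nonneg (hr0 d) (Nat.cast_nonneg K))
      push_cast [k]; linarith
    have hk2 : r d * K < k := by
      push_cast [k]; exact Nat.lt_floor_add_one _
    have e₁ : ∀ᶠ m in atTop, (k : ℝ) < q₁ (d, m) * K + 2 :=
      (((h₁ d).2.mul_const (K : ℝ)).add_const 2).eventually_const_lt hk1
    have e₂ : ∀ᶠ m in atTop, (0 : ℝ) < q₂ (d, m) * K + k :=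
      (((h₂ d).2.mul_const (K : ℝ)).add_const (k : ℝ)).eventually_const_lt (by linarith)
    obtain ⟨m, hm₁, hm₂⟩ := (e₁.and e₂).exists
    refine ⟨Nat.pair k m, ?_⟩
    simp only [p, Nat.unpair_pair, Bool.and_eq_true, decide_eq_true_eq]
    exact ⟨by exact_mod_cast hm₁, by exact_mod_cast hm₂⟩
  refine ⟨fun d => (g d).unpair.1, Computable.fst.comp (Computable.unpair.comp hg), fun d => ?_⟩
  have := hpg d
  simp only [p, Bool.and_eq_true, decide_eq_true_eq] at this
  obtain ⟨ha, hb⟩ := this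
  have ha' : (((g d).unpair.1 : ℕ) : ℝ) < q₁ (d, (g d).unpair.2) * K + 2 := by exact_mod_cast ha
  have hb' : (0 : ℝ) < q₂ (d, (g d).unpair.2) * K + (g d).unpair.1 := by exact_mod_cast hb
  have i₁ := mul_le_mul_of_nonneg_right (hmono₁ d (g d).unpair.2) (Nat.cast_nonneg (α := ℝ) K)
  have i₂ := mul_le_mul_of_nonneg_right (hmono₂ d (g d).unpair.2) (Nat.cast_nonneg (α := ℝ) K)
  constructor <;> linarith

end RealComputability

/-! ### Initial segments of paths and outcomes -/

theorem Path.length_initSeg (ω : Path) (n : ℕ) : (ω.initSeg n).length = n := by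
  simp [Path.initSeg]

theorem Path.initSeg_succ (ω : Path) (n : ℕ) : ω.initSeg (n + 1) = ω.initSeg n ++ [ω n] := by
  simp [Path.initSeg, List.range_succ]

theorem computable_initSeg {ω : Path} (hω : Primrec ω) : Computable ω.initSeg :=
  (Primrec.list_map Primrec.list_range (hω.comp Primrec.snd).to₂).to_comp

theorem bit_nonneg (x : Bool) : 0 ≤ bit x := by cases x <;> simp [bit]

theorem bit_le_one (x : Bool) : bit x ≤ 1 := by cases x <;> simp [bit]

/-! ### Multiplier processes -/

theorem generated_eq_prod_range (D : Situation → Bool → ℝ) (s : Situation) :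
    generated D s = ∏ k ∈ Finset.range s.length, D (s.take k) (s.getD k false) := by
  rw [Finset.prod_range, generated]
  exact Finset.prod_congr rfl fun k _ => by simp

theorem generated_nil (D : Situation → Bool → ℝ) : generated D [] = 1 := by
  simp [generated]

theorem generated_append (D : Situation → Bool → ℝ) (s : Situation) (x : Bool) :
    generated D (s ++ [x]) = generated D s * D s x := by
  rw [generated_eq_prod_range, generated_eq_prod_range, List.length_append, List.length_singleton,
    Finset.prod_range_succ]
  congr 1
  · refine Finset.prod_congr rfl fun k hk => ?_
    rw [Finset.mem_range] at hk
    rw [List.take_append_of_le_length hk.le, List.getD_append _ _ _ _ hk]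
  · simp

theorem generated_initSeg (D : Situation → Bool → ℝ) (ω : Path) (n : ℕ) :
    generated D (ω.initSeg n) = ∏ k ∈ Finset.range n, D (ω.initSeg k) (ω k) := by
  induction n with
  | zero => simp [Path.initSeg, generated_nil]
  | succ n ih => rw [Path.initSeg_succ, generated_append, ih, Finset.prod_range_succ]

theorem generated_nonneg {D : Situation → Bool → ℝ} (hD : ∀ s x, 0 ≤ D s x) (s : Situation) :
    0 ≤ generated D s :=
  Finset.prod_nonneg fun _ _ => hD _ _

theorem isTestSupermartingale_generated {φ : ForecastingSystem} {D : Situation → Bool → ℝ}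
    (hD : ∀ s x, 0 ≤ D s x) (hE : ∀ s, ∀ p ∈ (φ s).toSet, expectation p (D s) ≤ 1) :
    IsTestSupermartingale φ (generated D) := by
  refine ⟨fun s p hp => ?_, generated_nonneg hD, generated_nil D⟩
  have h := mul_nonneg (generated_nonneg hD s) (sub_nonneg.2 (hE s p hp))
  simp only [expectation, processDiff, generated_append] at h ⊢
  linarith

theorem computableReal_generated {f : Situation × Bool → ℕ} (hf : Computable f) {B : ℕ}
    (hB : B ≠ 0) : ComputableReal (generated fun s x => (f (s, x) : ℝ) / B) := by
  have htake : Computable fun p : Situation × ℕ => p.1.take p.2 :=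
    Primrec.list_take.to_comp.comp Computable.snd Computable.fst
  have hget : Computable fun p : Situation × ℕ => p.1.getD p.2 false :=
    (Primrec.list_getD false).to_comp.comp Computable.fst Computable.snd
  have h := computableReal_natCast_div
    (computable_prod_range Computable.list_length (hf.comp (htake.pair hget)).to₂)
    (computable_const_pow B Computable.list_length) fun s => pow_ne_zero _ hB
  convert h using 2 with s
  rw [generated_eq_prod_range, Finset.prod_div_distrib]
  simp

/-- A multiplier process with computable natural numerators and a fixed denominator generates a
test supermartingale that is a test for each of the test-theoretic notions at once. -/
theorem generated_mem_tests {φ : ForecastingSystem} {f : Situation × Bool → ℕ}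
    (hf : Computable f) {B : ℕ} (hB : B ≠ 0)
    (hE : ∀ s, ∀ p ∈ (φ s).toSet, expectation p (fun x => f (s, x)) ≤ B) :
    generated (fun s x => (f (s, x) : ℝ) / B) ∈ mlTests φ ∩ wmlTests φ ∩ compTests φ := by
  have hB0 : (0 : ℝ) < B := by exact_mod_cast Nat.pos_of_ne_zero hB
  have hD : ∀ s x, 0 ≤ (f (s, x) : ℝ) / B := fun s x => by positivity
  have hT : IsTestSupermartingale φ (generated fun s x => (f (s, x) : ℝ) / B) := by
    refine isTestSupermartingale_generated hD fun s p hp => ?_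
    have := (div_le_one hB0).2 (hE s p hp)
    refine le_of_eq_of_le ?_ this
    simp only [expectation]
    ring
  have hc := computableReal_generated hf hB
  exact ⟨⟨⟨hT, hc.1⟩, hT, _, hD,
    (computableReal_natCast_div hf (Computable.const B) fun _ => hB).1, rfl⟩, hT, hc⟩

/-! ### Unboundedness along a path -/

theorem unboundedOn_iff {T : Situation → ℝ} {ω : Path} :
    UnboundedOn T ω ↔ ∀ B : ℝ, ∃ᶠ n in atTop, B < T (ω.initSeg n) := by
  rw [UnboundedOn, ← top_le_iff]
  constructor
  · intro h B
    have := frequently_lt_of_lt_limsup (by isBoundedDefault)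
      ((EReal.coe_lt_top B).trans_le h)
    exact this.mono fun n hn => by exact_mod_cast hn
  · intro h
    rw [le_limsup_iff]
    intro y hy
    obtain ⟨z, hyz, -⟩ := EReal.lt_iff_exists_real_btwn.1 hy
    exact (h z).mono fun n hn => hyz.trans (by exact_mod_cast hn)

theorem zero_le_limsup_coe_iff {u : ℕ → ℝ} :
    0 ≤ limsup (fun n => ((u n : ℝ) : EReal)) atTop ↔ ∀ ε > 0, ∃ᶠ n in atTop, -ε < u n := by
  rw [le_limsup_iff]
  constructor
  · intro h ε hε
    have hε' : ((-ε : ℝ) : EReal) < 0 := by exact_mod_cast neg_lt_zero.2 hε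
    exact (h _ hε').mono fun n hn => by exact_mod_cast hn
  · intro h y hy
    obtain ⟨z, hyz, hz⟩ := EReal.lt_iff_exists_real_btwn.1 hy
    have hz' : z < 0 := by exact_mod_cast hz
    refine (h (-z) (neg_pos.2 hz')).mono fun n hn => hyz.trans ?_
    rw [neg_neg] at hn
    exact_mod_cast hn

theorem ComputablyUnboundedOn.unboundedOn {T : Situation → ℝ} {ω : Path}
    (h : ComputablyUnboundedOn T ω) : UnboundedOn T ω := by
  obtain ⟨τ, hτ, hT⟩ := h
  rw [unboundedOn_iff]
  intro B
  refine ((zero_le_limsup_coe_iff.1 hT 1 one_pos).and_eventually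
    (hτ.2.2.2.eventually_gt_atTop (B + 1))).mono fun n hn => ?_
  linarith [hn.1, hn.2]

/-! ### The frequency condition as a pair of linear bounds -/

/-- The sum over the selected outcomes among the first `n` ones of the difference between the
outcome and the forecast `f`. -/
def selectedSum (S : SelectionProcess) (f : Situation → ℝ) (ω : Path) (n : ℕ) : ℝ :=
  ∑ k ∈ Finset.range n, bit (S (ω.initSeg k)) * (bit (ω k) - f (ω.initSeg k))

theorem selectionCount_nonneg (S : SelectionProcess) (ω : Path) (n : ℕ) :
    0 ≤ selectionCount S ω n :=
  Finset.sum_nonneg fun _ _ => bit_nonneg _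

theorem abs_selectedSum_le (S : SelectionProcess) {f : Situation → ℝ} (h0 : ∀ s, 0 ≤ f s)
    (h1 : ∀ s, f s ≤ 1) (ω : Path) (n : ℕ) : |selectedSum S f ω n| ≤ selectionCount S ω n := by
  refine (Finset.abs_sum_le_sum_abs _ _).trans (Finset.sum_le_sum fun k _ => ?_)
  rw [abs_mul, abs_of_nonneg (bit_nonneg _)]
  refine mul_le_of_le_one_right (bit_nonneg _) (abs_le.2 ⟨?_, ?_⟩) <;>
    linarith [bit_nonneg (ω k), bit_le_one (ω k), h0 (ω.initSeg k), h1 (ω.initSeg k)]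

theorem abs_selectedAverage_le_one (S : SelectionProcess) {f : Situation → ℝ} (h0 : ∀ s, 0 ≤ f s)
    (h1 : ∀ s, f s ≤ 1) (ω : Path) (n : ℕ) : |selectedAverage S f ω n| ≤ 1 := by
  change |selectedSum S f ω n / selectionCount S ω n| ≤ 1
  rw [abs_div, abs_of_nonneg (selectionCount_nonneg S ω n)]
  exact div_le_one_of_le₀ (abs_selectedSum_le S h0 h1 ω n) (selectionCount_nonneg S ω n)

theorem zero_le_liminf_selectedAverage_iff {S : SelectionProcess} {f : Situation → ℝ}
    (h0 : ∀ s, 0 ≤ f s) (h1 : ∀ s, f s ≤ 1) {ω : Path}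
    (hS : Tendsto (selectionCount S ω) atTop atTop) :
    0 ≤ liminf (selectedAverage S f ω) atTop ↔
      ∀ δ > 0, ∀ᶠ n in atTop, -(δ * selectionCount S ω n) < selectedSum S f ω n := by
  have hb := abs_selectedAverage_le_one S h0 h1 ω
  rw [le_liminf_iff (isCoboundedUnder_ge_of_le atTop fun n => (abs_le.1 (hb n)).2)
    (isBoundedUnder_of ⟨-1, fun n => (abs_le.1 (hb n)).1⟩)]
  have key : ∀ n, 0 < selectionCount S ω n → ∀ y, (y < selectedAverage S f ω n ↔
      y * selectionCount S ω n < selectedSum S f ω n) := fun n hn y => lt_div_iff₀ hn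
  constructor
  · intro h δ hδ
    filter_upwards [h (-δ) (neg_lt_zero.2 hδ), hS.eventually_gt_atTop 0] with n hn hn0
    rw [key n hn0] at hn
    linarith
  · intro h y hy
    filter_upwards [h (-y) (neg_pos.2 hy), hS.eventually_gt_atTop 0] with n hn hn0
    rw [key n hn0]
    linarith

theorem limsup_selectedAverage_le_zero_iff {S : SelectionProcess} {f : Situation → ℝ}
    (h0 : ∀ s, 0 ≤ f s) (h1 : ∀ s, f s ≤ 1) {ω : Path}
    (hS : Tendsto (selectionCount S ω) atTop atTop) :
    limsup (selectedAverage S f ω) atTop ≤ 0 ↔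
      ∀ δ > 0, ∀ᶠ n in atTop, selectedSum S f ω n < δ * selectionCount S ω n := by
  have hb := abs_selectedAverage_le_one S h0 h1 ω
  rw [limsup_le_iff (isCoboundedUnder_le_of_le atTop fun n => (abs_le.1 (hb n)).1)
    (isBoundedUnder_of ⟨1, fun n => (abs_le.1 (hb n)).2⟩)]
  have key : ∀ n, 0 < selectionCount S ω n → ∀ y, (selectedAverage S f ω n < y ↔
      selectedSum S f ω n < y * selectionCount S ω n) := fun n hn y => div_lt_iff₀ hn
  constructor
  · intro h δ hδ
    filter_upwards [h δ hδ, hS.eventually_gt_atTop 0] with n hn hn0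
    rwa [key n hn0] at hn
  · intro h y hy
    filter_upwards [h y hy, hS.eventually_gt_atTop 0] with n hn hn0
    rwa [key n hn0]

theorem frequencyCondition_iff {φ : ForecastingSystem} {ω : Path} {S : SelectionProcess} :
    FrequencyCondition φ ω S ↔ (Tendsto (selectionCount S ω) atTop atTop →
      (∀ δ > 0, ∀ᶠ n in atTop,
        -(δ * selectionCount S ω n) < selectedSum S (fun s => (φ s).lo) ω n) ∧
      ∀ δ > 0, ∀ᶠ n in atTop,
        selectedSum S (fun s => (φ s).hi) ω n < δ * selectionCount S ω n) := by
  refine forall_congr' fun hS => and_congr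
    (zero_le_liminf_selectedAverage_iff (fun s => (φ s).zero_le)
      (fun s => (φ s).lo_le_hi.trans (φ s).le_one) hS)
    (limsup_selectedAverage_le_zero_iff (fun s => (φ s).zero_le.trans (φ s).lo_le_hi)
      (fun s => (φ s).le_one) hS)

/-! ### A test supermartingale against a violated frequency condition -/

/-- The exponential form of the bound `z - 2 z² ≤ log (1 + z)`. -/
theorem exp_sub_two_sq_le_one_add {z : ℝ} (hz : -(1 / 2) ≤ z) :
    Real.exp (z - 2 * z ^ 2) ≤ 1 + z := by
  have hpos : 0 < 1 + z := by linarith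
  rw [← Real.le_log_iff_exp_le hpos]
  refine le_trans ?_ (Real.one_sub_inv_le_log_of_pos hpos)
  have : 1 - (1 + z)⁻¹ = z / (1 + z) := by field_simp; ring
  rw [this, le_div_iff₀ hpos]
  nlinarith [mul_nonneg (sq_nonneg z) (by linarith : 0 ≤ 1 + 2 * z)]

/-- For a temporal selection process the number of selected outcomes is the same on all paths, so a
positive multiple of it is computable. -/
theorem isGrowthFunction_selectionCount_div {S : SelectionProcess} (hS : Computable S)
    (htemp : S.Temporal) {ω : Path} (hlim : Tendsto (selectionCount S ω) atTop atTop) {m : ℕ}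
    (hm : m ≠ 0) : IsGrowthFunction fun n => selectionCount S ω n / m := by
  have hm0 : (0 : ℝ) < m := by exact_mod_cast Nat.pos_of_ne_zero hm
  let z : Path := fun _ => false
  refine ⟨?_, fun n => div_nonneg (selectionCount_nonneg S ω n) hm0.le, ?_,
    hlim.atTop_div_const hm0⟩
  · -- By temporality the count can be computed along the path of zeros.
    have hc : Computable fun k : ℕ => if S (z.initSeg k) = true then 1 else 0 :=
      computable_ite (hS.comp (computable_initSeg (Primrec.const false))) (Computable.const 1)
        (Computable.const 0)
    convert computableReal_natCast_div
      (computable_sum_range Computable.id (hc.comp Computable.snd).to₂) (Computable.const m)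
      (fun _ : ℕ => hm) using 3 with n
    rw [selectionCount, Nat.cast_sum]
    refine Finset.sum_congr rfl fun k _ => ?_
    rw [htemp (ω.initSeg k) (z.initSeg k) (by simp only [Path.length_initSeg])]
    simp [bit]
  · refine monotone_nat_of_le_succ fun n => div_le_div_of_nonneg_right ?_ hm0.le
    rw [selectionCount, selectionCount, Finset.sum_range_succ]
    linarith [bit_nonneg (S (ω.initSeg n))]

/-- Betting a fixed small fraction `1 / e` of the capital on the gamble `(f - 2K) / K` whenever `S`
selects makes the capital grow exponentially in the number of selected outcomes, infinitely often,
as soon as the average gain of the gamble exceeds `δ` infinitely often. -/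
theorem exists_test_of_gamble {φ : ForecastingSystem} {ω : Path} {S : SelectionProcess}
    (hS : Computable S) (htemp : S.Temporal)
    (hlim : Tendsto (selectionCount S ω) atTop atTop) {f : Situation × Bool → ℕ}
    (hf : Computable f) {K : ℕ} (hK : K ≠ 0) (hfK : ∀ d, f d ≤ 4 * K)
    (hE : ∀ s, ∀ p ∈ (φ s).toSet, expectation p (fun x => f (s, x)) ≤ 2 * K)
    {δ : ℝ} (hδ : 0 < δ)
    (hfreq : ∃ᶠ n in atTop, δ * selectionCount S ω n <
      ∑ k ∈ Finset.range n, bit (S (ω.initSeg k)) * (((f (ω.initSeg k, ω k) : ℝ) - 2 * K) / K)) :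
    ∃ T ∈ mlTests φ ∩ wmlTests φ ∩ compTests φ, ComputablyUnboundedOn T ω := by
  have hK0 : (0 : ℝ) < K := by exact_mod_cast Nat.pos_of_ne_zero hK
  -- With gains `y` in `[-2, 2]`, `4 ≤ e` keeps `y / e` in the range of `exp_sub_two_sq_le_one_add`,
  -- and `16 / δ ≤ e` makes the quadratic loss `8 / e ^ 2` at most half of the gain `δ / e`.
  obtain ⟨e, he⟩ := exists_nat_ge (4 + 16 / δ)
  have hδ16 : 0 < 16 / δ := by positivity
  have he4 : (4 : ℝ) ≤ e := by linarith
  have he4' : 4 ≤ e := by exact_mod_cast he4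
  have he0 : (0 : ℝ) < e := by linarith
  have heδ : 16 ≤ δ * e := by
    have : 16 / δ ≤ e := by linarith
    rwa [div_le_iff₀' hδ] at this
  -- The growth function is the number of selected outcomes divided by `m`.
  obtain ⟨m, hm⟩ := exists_nat_ge (2 * e / δ)
  have hm0 : (0 : ℝ) < m := lt_of_lt_of_le (by positivity) hm
  have hm1 : 1 / (m : ℝ) ≤ δ / (2 * e) := by
    rw [div_le_div_iff₀ hm0 (by positivity)]
    rw [div_le_iff₀ hδ] at hm
    linarith
  let g : Situation × Bool → ℕ := fun d => if S d.1 = true then (e - 2) * K + f d else e * K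
  have hg : Computable g := computable_ite (hS.comp Computable.fst)
    (computable_add (Computable.const _) hf) (Computable.const _)
  have hB : e * K ≠ 0 := mul_ne_zero (by omega) hK
  have hgE : ∀ s, ∀ p ∈ (φ s).toSet, expectation p (fun x => g (s, x)) ≤ ((e * K : ℕ) : ℝ) := by
    intro s p hp
    have h := hE s p hp
    simp only [expectation, g] at h ⊢
    split_ifs
    · push_cast [Nat.cast_sub (by omega : 2 ≤ e)]
      linarith
    · push_cast; linarith
  have hmul : ∀ k, Real.exp (bit (S (ω.initSeg k)) *
      (((f (ω.initSeg k, ω k) : ℝ) - 2 * K) / K / e - 8 / e ^ 2)) ≤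
      (g (ω.initSeg k, ω k) : ℝ) / (e * K : ℕ) := by
    intro k
    by_cases hk : S (ω.initSeg k) = true
    · have hup : (f (ω.initSeg k, ω k) : ℝ) ≤ 4 * K := by exact_mod_cast hfK _
      set F : ℝ := (f (ω.initSeg k, ω k) : ℝ)
      have hF : 0 ≤ F := Nat.cast_nonneg _
      set y : ℝ := (F - 2 * K) / K with hy
      have hyl : -2 ≤ y := by rw [hy, le_div_iff₀ hK0]; linarith
      have hyu : y ≤ 2 := by rw [hy, div_le_iff₀ hK0]; linarith
      have hz : -(1 / 2) ≤ y / e := by rw [le_div_iff₀ he0]; linarith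
      have hval : (g (ω.initSeg k, ω k) : ℝ) / (e * K : ℕ) = 1 + y / e := by
        simp only [g, hk, if_true]
        push_cast [Nat.cast_sub (by omega : 2 ≤ e)]
        rw [hy]
        field_simp
        ring
      rw [hval, hk]
      refine le_trans (Real.exp_le_exp.2 ?_) (exp_sub_two_sq_le_one_add hz)
      have : y ^ 2 / e ^ 2 ≤ 4 / e ^ 2 :=
        div_le_div_of_nonneg_right (by nlinarith) (by positivity)
      simp only [bit, if_true, one_mul, div_pow]
      have h8 : (8 : ℝ) / e ^ 2 = 2 * (4 / e ^ 2) := by ring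
      rw [h8]
      linarith
    · simp only [g, hk, bit]
      rw [if_neg (by simp), if_neg (by simp), zero_mul, Real.exp_zero, div_self]
      exact_mod_cast hB
  refine ⟨_, generated_mem_tests hg hB hgE, _,
    isGrowthFunction_selectionCount_div hS htemp hlim (m := m) (by rintro rfl; simp at hm0), ?_⟩
  rw [zero_le_limsup_coe_iff]
  intro ε hε
  refine hfreq.mono fun n hn => ?_
  set N := selectionCount S ω n with hN
  have hN0 : 0 ≤ N := selectionCount_nonneg S ω n
  have hsum : ∑ k ∈ Finset.range n, bit (S (ω.initSeg k)) *
      (((f (ω.initSeg k, ω k) : ℝ) - 2 * K) / K / e - 8 / e ^ 2) =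
      (∑ k ∈ Finset.range n, bit (S (ω.initSeg k)) *
        (((f (ω.initSeg k, ω k) : ℝ) - 2 * K) / K)) / e - N * (8 / e ^ 2) := by
    rw [hN, selectionCount, Finset.sum_mul, Finset.sum_div, ← Finset.sum_sub_distrib]
    exact Finset.sum_congr rfl fun k _ => by ring
  have hlow : N / m ≤ ∑ k ∈ Finset.range n, bit (S (ω.initSeg k)) *
      (((f (ω.initSeg k, ω k) : ℝ) - 2 * K) / K / e - 8 / e ^ 2) := by
    rw [hsum]
    have h1 : N / m ≤ N * (δ / (2 * e)) := by
      have := mul_le_mul_of_nonneg_left hm1 hN0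
      rwa [mul_one_div] at this
    have h2 : δ * N / e ≤ (∑ k ∈ Finset.range n, bit (S (ω.initSeg k)) *
        (((f (ω.initSeg k, ω k) : ℝ) - 2 * K) / K)) / e := by gcongr
    have h3 : (8 : ℝ) / e ^ 2 ≤ δ / (2 * e) := by
      rw [div_le_div_iff₀ (by positivity) (by positivity)]
      nlinarith
    have h4 := mul_le_mul_of_nonneg_left h3 hN0
    have h5 : δ * N / e = N * (δ / (2 * e)) + N * (δ / (2 * e)) := by field_simp; ring
    linarith
  have hT : N / m ≤ generated (fun s x => (g (s, x) : ℝ) / (e * K : ℕ)) (ω.initSeg n) := by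
    rw [generated_initSeg]
    refine le_trans ?_ (Finset.prod_le_prod (fun k _ => (Real.exp_pos _).le) fun k _ => hmul k)
    rw [← Real.exp_sum]
    linarith [Real.add_one_le_exp (∑ k ∈ Finset.range n, bit (S (ω.initSeg k)) *
      (((f (ω.initSeg k, ω k) : ℝ) - 2 * K) / K / e - 8 / e ^ 2))]
  linarith

theorem computable_bit_mul (K : ℕ) :
    Computable fun d : Situation × Bool => if d.2 = true then K else 0 :=
  computable_ite Computable.snd (Computable.const K) (Computable.const 0)

theorem exists_nat_two_div_le {δ : ℝ} (hδ : 0 < δ) : ∃ K : ℕ, 2 ≤ K ∧ 2 / (K : ℝ) ≤ δ := by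
  obtain ⟨K, hK⟩ := exists_nat_ge (2 + 2 / δ)
  have hδ2 : 0 < 2 / δ := by positivity
  refine ⟨K, by exact_mod_cast (by linarith : (2 : ℝ) ≤ K), ?_⟩
  rw [div_le_comm₀ (by linarith) hδ]
  linarith

/-- If the frequency condition fails for a temporal selection process, then the gamble on the
outcome against a rational approximation of the forecast, from the safe side, yields a test. -/
theorem exists_test_of_not_frequencyCondition {φ : ForecastingSystem} (hcomp : φ.IsComputable)
    {ω : Path} {S : SelectionProcess} (hS : Computable S) (htemp : S.Temporal)
    (h : ¬ FrequencyCondition φ ω S) :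
    ∃ T ∈ mlTests φ ∩ wmlTests φ ∩ compTests φ, ComputablyUnboundedOn T ω := by
  rw [frequencyCondition_iff] at h
  push Not at h
  obtain ⟨hlim, h⟩ := h
  -- In either case `K` is so large that the rational approximation costs at most half of the
  -- average gain `δ`; the gamble is scaled and shifted so as to have values in `ℕ`.
  by_cases hlow : ∀ δ > 0, ∀ᶠ n in atTop,
      -(δ * selectionCount S ω n) < selectedSum S (fun s => (φ s).lo) ω n
  · obtain ⟨δ, hδ, hfreq⟩ := h hlow
    obtain ⟨K, hK2, hKδ⟩ := exists_nat_two_div_le (half_pos hδ)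
    have hK0 : (0 : ℝ) < K := by exact_mod_cast (by omega : 0 < K)
    obtain ⟨a, ha, hak⟩ := hcomp.2.exists_approx
      (fun s => (φ s).zero_le.trans (φ s).lo_le_hi) K
    have haK : ∀ s, a s ≤ K + 2 := fun s => by
      have := mul_le_mul_of_nonneg_right (φ s).le_one hK0.le
      have : (a s : ℝ) ≤ K + 2 := by linarith [(hak s).2]
      exact_mod_cast this
    have hcast : ∀ s x, ((2 * K + (if x = true then K else 0) - a s : ℕ) : ℝ) =
        2 * K + K * bit x - a s := fun s x => by
      have := haK s
      rw [Nat.cast_sub (by omega)]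
      cases x <;> simp [bit]
    refine exists_test_of_gamble hS htemp hlim (K := K) (δ := δ / 4)
      (f := fun d => 2 * K + (if d.2 = true then K else 0) - a d.1)
      (computable_sub (computable_add (Computable.const _) (computable_bit_mul K))
        (ha.comp Computable.fst)) (by omega) (fun d => ?_) (fun s p hp => ?_) (by positivity)
      ((hfreq.and_eventually (hlim.eventually_gt_atTop 0)).mono fun n ⟨hn, hn0⟩ => ?_)
    · split_ifs <;> omega
    · simp only [hcast]
      simp only [expectation, bit]
      have := mul_le_mul_of_nonneg_right hp.2 hK0.le
      simp only [if_true, Bool.false_eq_true, if_false]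
      linarith [(hak s).1]
    · simp only [hcast]
      have hle : selectedSum S (fun s => (φ s).hi) ω n - selectionCount S ω n * (2 / K) ≤
          ∑ k ∈ Finset.range n, bit (S (ω.initSeg k)) *
            ((2 * K + K * bit (ω k) - a (ω.initSeg k) - 2 * K) / K) := by
        rw [selectedSum, selectionCount, Finset.sum_mul, ← Finset.sum_sub_distrib]
        refine Finset.sum_le_sum fun k _ => ?_
        rw [← mul_sub]
        refine mul_le_mul_of_nonneg_left ?_ (bit_nonneg _)
        rw [le_div_iff₀ hK0, sub_mul, div_mul_cancel₀ _ hK0.ne']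
        linarith [(hak (ω.initSeg k)).2]
      linarith [mul_le_mul_of_nonneg_left hKδ hn0.le, mul_pos hδ hn0]
  · push Not at hlow
    obtain ⟨δ, hδ, hfreq⟩ := hlow
    obtain ⟨K, hK2, hKδ⟩ := exists_nat_two_div_le (half_pos hδ)
    have hK0 : (0 : ℝ) < K := by exact_mod_cast (by omega : 0 < K)
    obtain ⟨a, ha, hak⟩ := hcomp.1.exists_approx (fun s => (φ s).zero_le) K
    have haK : ∀ s, a s ≤ K + 2 := fun s => by
      have := mul_le_mul_of_nonneg_right ((φ s).lo_le_hi.trans (φ s).le_one) hK0.le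
      have : (a s : ℝ) ≤ K + 2 := by linarith [(hak s).2]
      exact_mod_cast this
    have hcast : ∀ s x, ((2 * K + a s - (2 + if x = true then K else 0) : ℕ) : ℝ) =
        2 * K + a s - 2 - K * bit x := fun s x => by
      rw [Nat.cast_sub (by split_ifs <;> omega)]
      cases x
      · simp [bit]
      · simp only [bit, if_true]; push_cast; ring
    refine exists_test_of_gamble hS htemp hlim (K := K) (δ := δ / 4)
      (f := fun d => 2 * K + a d.1 - (2 + if d.2 = true then K else 0))
      (computable_sub (computable_add (Computable.const _) (ha.comp Computable.fst))
        (computable_add (Computable.const _) (computable_bit_mul K)))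
      (by omega) (fun d => ?_) (fun s p hp => ?_) (by positivity)
      ((hfreq.and_eventually (hlim.eventually_gt_atTop 0)).mono fun n ⟨hn, hn0⟩ => ?_)
    · have := haK d.1
      omega
    · simp only [hcast]
      simp only [expectation, bit]
      have := mul_le_mul_of_nonneg_right hp.1 hK0.le
      simp only [if_true, Bool.false_eq_true, if_false]
      linarith [(hak s).2]
    · simp only [hcast]
      have hle : -selectedSum S (fun s => (φ s).lo) ω n - selectionCount S ω n * (2 / K) ≤
          ∑ k ∈ Finset.range n, bit (S (ω.initSeg k)) *
            ((2 * K + a (ω.initSeg k) - 2 - K * bit (ω k) - 2 * K) / K) := by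
        rw [selectedSum, selectionCount, Finset.sum_mul, ← Finset.sum_neg_distrib,
          ← Finset.sum_sub_distrib]
        refine Finset.sum_le_sum fun k _ => ?_
        rw [← mul_neg, ← mul_sub]
        refine mul_le_mul_of_nonneg_left ?_ (bit_nonneg _)
        rw [le_div_iff₀ hK0, sub_mul, div_mul_cancel₀ _ hK0.ne']
        linarith [(hak (ω.initSeg k)).1]
      linarith [mul_le_mul_of_nonneg_left hKδ hn0.le, mul_pos hδ hn0]

theorem IsRandom.wCH {R : Notion} {φ : ForecastingSystem} (hcomp : φ.IsComputable) {ω : Path}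
    (h : IsRandom R φ ω) : IsRandom .wCH φ ω := by
  intro S hS htemp
  by_contra hcon
  obtain ⟨T, ⟨⟨hml, hwml⟩, hc⟩, hT⟩ := exists_test_of_not_frequencyCondition hcomp hS htemp hcon
  cases R with
  | ML => exact h T hml hT.unboundedOn
  | wML => exact h T hwml hT.unboundedOn
  | C => exact h T hc hT.unboundedOn
  | S => exact h T hc hT
  | CH => exact hcon (h S hS)
  | wCH => exact hcon (h S hS htemp)

/-! ### Transfer of randomness to a larger stationary forecast -/

/-- The process `T`, divided by a further factor `M` at each of the first `N` steps. -/
noncomputable def damped (M N : ℕ) (T : Situation → ℝ) (s : Situation) : ℝ :=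
  T s / (M ^ min s.length N : ℕ)

theorem damped_initSeg {M N : ℕ} (T : Situation → ℝ) (ω : Path) {n : ℕ} (hn : N ≤ n) :
    damped M N T (ω.initSeg n) = T (ω.initSeg n) / (M ^ N : ℕ) := by
  rw [damped, Path.length_initSeg, min_eq_right hn]

theorem computable_min_length (N : ℕ) : Computable fun s : Situation => min s.length N :=
  (computable_ite (computable_decide_lt Computable.list_length (Computable.const N))
    Computable.list_length (Computable.const N)).of_eq fun s => by
      by_cases h : s.length < N
      · simp [h, h.le]
      · simp [h, not_lt.1 h]

theorem damped_generated {M : ℕ} (hM : M ≠ 0) (N : ℕ) (D : Situation → Bool → ℝ) :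
    damped M N (generated D) =
      generated fun s x => D s x / (if decide (s.length < N) = true then M else 1 : ℕ) := by
  have hM0 : (M : ℝ) ≠ 0 := by exact_mod_cast hM
  funext s
  induction s using List.reverseRecOn with
  | nil => simp [damped, generated_nil]
  | append_singleton s x ih =>
    rw [generated_append, ← ih, damped, damped, generated_append, List.length_append,
      List.length_singleton]
    by_cases h : s.length < N
    · have h1 : min (s.length + 1) N = s.length + 1 := min_eq_left h
      rw [h1, min_eq_left h.le]
      simp only [h, decide_true, if_true]
      push_cast
      rw [div_mul_div_comm, pow_succ]
    · have h1 : min (s.length + 1) N = N := min_eq_right (by omega)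
      rw [h1, min_eq_right (by omega)]
      simp only [h, decide_false, Bool.false_eq_true, if_false]
      push_cast
      field_simp

section

variable {φ : ForecastingSystem} {I : IntervalForecast} {N M : ℕ} {p : ℝ}

/-- A non-negative supermartingale for an interval that contains some `p` in `(0, 1)` can grow in
one step by a factor of at most `max (1 / p) (1 / (1 - p))`. Dividing by `M` cancels this growth, so
that no condition on the forecasts in the first `N` steps is needed. -/
theorem IsTestSupermartingale.damped {T : Situation → ℝ}
    (hT : IsTestSupermartingale (stationary I) T) (hp : p ∈ I.toSet) (hp0 : 0 < p) (hp1 : p < 1)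
    (hMp : 1 ≤ M * p) (hMp' : 1 ≤ M * (1 - p))
    (hsub : ∀ s : Situation, N ≤ s.length → (φ s).toSet ⊆ I.toSet) :
    IsTestSupermartingale φ (damped M N T) := by
  obtain ⟨hsup, hnn, hone⟩ := hT
  have hM0 : (0 : ℝ) < M := by
    by_contra h
    nlinarith
  refine ⟨fun s r hr => ?_, fun s => div_nonneg (hnn s) (Nat.cast_nonneg _), by
    simp [ImpreciseRandomness.damped, hone]⟩
  simp only [expectation, processDiff, ImpreciseRandomness.damped, List.length_append,
    List.length_singleton]
  by_cases h : s.length < N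
  · have h1 : min (s.length + 1) N = s.length + 1 := min_eq_left h
    rw [h1, min_eq_left h.le]
    have hr0 : 0 ≤ r := (φ s).zero_le.trans hr.1
    have hr1 : r ≤ 1 := hr.2.trans (φ s).le_one
    have hs := hsup s p hp
    simp only [expectation, processDiff] at hs
    have ht := hnn (s ++ [true])
    have hf := hnn (s ++ [false])
    have hpt : p * T (s ++ [true]) ≤ T s := by nlinarith
    have hpf : (1 - p) * T (s ++ [false]) ≤ T s := by nlinarith
    have hst : T (s ++ [true]) ≤ M * T s := by nlinarith
    have hsf : T (s ++ [false]) ≤ M * T s := by nlinarith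
    have hW : (0 : ℝ) < M ^ s.length := by positivity
    have hdt : T (s ++ [true]) / (M ^ (s.length + 1) : ℕ) ≤ T s / (M ^ s.length : ℕ) := by
      push_cast
      rw [div_le_div_iff₀ (by positivity) hW, pow_succ]
      nlinarith
    have hdf : T (s ++ [false]) / (M ^ (s.length + 1) : ℕ) ≤ T s / (M ^ s.length : ℕ) := by
      push_cast
      rw [div_le_div_iff₀ (by positivity) hW, pow_succ]
      nlinarith
    linarith [mul_nonneg hr0 (sub_nonneg.2 hdt), mul_nonneg (sub_nonneg.2 hr1) (sub_nonneg.2 hdf)]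
  · have h1 : min (s.length + 1) N = N := min_eq_right (by omega)
    rw [h1, min_eq_right (by omega)]
    have hs := hsup s r (hsub s (by omega) hr)
    have hW : (0 : ℝ) ≤ (M ^ N : ℕ) := Nat.cast_nonneg _
    refine le_of_eq_of_le ?_ (div_nonpos_of_nonpos_of_nonneg hs hW)
    simp only [expectation, processDiff]
    ring

theorem computable_damping (M N : ℕ) : Computable fun s : Situation => M ^ min s.length N :=
  computable_const_pow M (computable_min_length N)

theorem damped_mem_wmlTests (hM : M ≠ 0) {T : Situation → ℝ} (hT : T ∈ wmlTests (stationary I))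
    (hd : IsTestSupermartingale φ (damped M N T)) : damped M N T ∈ wmlTests φ := by
  obtain ⟨-, D, hD, hlsc, rfl⟩ := hT
  refine ⟨hd, _, fun s x => div_nonneg (hD s x) (Nat.cast_nonneg _), ?_, damped_generated hM N D⟩
  refine hlsc.div_nat (g := fun d => if decide (d.1.length < N) = true then M else 1)
    (computable_ite (computable_decide_lt (Computable.list_length.comp Computable.fst)
      (Computable.const N)) (Computable.const M) (Computable.const 1)) fun d => ?_
  split_ifs <;> simp [hM]

theorem UnboundedOn.damped {T : Situation → ℝ} {ω : Path} (hM : M ≠ 0) (h : UnboundedOn T ω)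
    (N : ℕ) : UnboundedOn (damped M N T) ω := by
  have hW : (0 : ℝ) < (M ^ N : ℕ) := by positivity
  rw [unboundedOn_iff] at h ⊢
  intro B
  refine ((h (B * (M ^ N : ℕ))).and_eventually (eventually_ge_atTop N)).mono fun n hn => ?_
  rw [damped_initSeg T ω hn.2, lt_div_iff₀ hW]
  exact hn.1

theorem ComputablyUnboundedOn.damped {T : Situation → ℝ} {ω : Path} (hM : M ≠ 0)
    (h : ComputablyUnboundedOn T ω) (N : ℕ) : ComputablyUnboundedOn (damped M N T) ω := by
  have hW : (0 : ℝ) < (M ^ N : ℕ) := by positivity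
  obtain ⟨τ, ⟨hc, h0, hmono, hlim⟩, hT⟩ := h
  refine ⟨fun n => τ n / (M ^ N : ℕ),
    ⟨hc.div_nat (Computable.const (M ^ N)) fun _ => pow_ne_zero _ hM,
      fun n => div_nonneg (h0 n) hW.le, fun a b hab => div_le_div_of_nonneg_right (hmono hab) hW.le,
      hlim.atTop_div_const hW⟩, ?_⟩
  rw [zero_le_limsup_coe_iff] at hT ⊢
  intro ε hε
  refine ((hT (ε * (M ^ N : ℕ)) (by positivity)).and_eventually
    (eventually_ge_atTop N)).mono fun n hn => ?_
  rw [damped_initSeg T ω hn.2, ← sub_div, lt_div_iff₀ hW]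
  linarith [hn.1]

end

theorem selectedSum_sub_natCast_le {S : SelectionProcess} {f g : Situation → ℝ} {ω : Path} {N : ℕ}
    (hf : ∀ s, f s ≤ 1) (hg : ∀ s, 0 ≤ g s) (hfg : ∀ s : Situation, N ≤ s.length → f s ≤ g s)
    (n : ℕ) : selectedSum S g ω n - N ≤ selectedSum S f ω n := by
  have hterm : ∀ k, bit (S (ω.initSeg k)) * (bit (ω k) - g (ω.initSeg k)) -
      bit (S (ω.initSeg k)) * (bit (ω k) - f (ω.initSeg k)) ≤ if k < N then 1 else 0 := by
    intro k
    have hb := bit_nonneg (S (ω.initSeg k))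
    have hb1 := bit_le_one (S (ω.initSeg k))
    split_ifs with hk
    · nlinarith [hf (ω.initSeg k), hg (ω.initSeg k)]
    · have := hfg (ω.initSeg k) (by rw [Path.length_initSeg]; omega)
      nlinarith
  have h := Finset.sum_le_sum fun k (_ : k ∈ Finset.range n) => hterm k
  rw [Finset.sum_sub_distrib, ← Finset.sum_filter, Finset.sum_const, nsmul_one] at h
  have hcard : ((Finset.range n).filter (· < N)).card ≤ N := by
    refine (Finset.card_le_card (t := Finset.range N) fun k hk => ?_).trans
      (Finset.card_range N).le
    simpa using (Finset.mem_filter.1 hk).2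
  have hcard' : (((Finset.range n).filter (· < N)).card : ℝ) ≤ N := by exact_mod_cast hcard
  simp only [selectedSum]
  linarith

theorem FrequencyCondition.of_eventually_le {φ ψ : ForecastingSystem} {ω : Path}
    {S : SelectionProcess} {N : ℕ}
    (hsub : ∀ s : Situation, N ≤ s.length → (ψ s).lo ≤ (φ s).lo ∧ (φ s).hi ≤ (ψ s).hi)
    (h : FrequencyCondition φ ω S) : FrequencyCondition ψ ω S := by
  rw [frequencyCondition_iff] at h ⊢
  intro hlim
  -- The finitely many early terms contribute at most `N`, half of the allowed `δ` in the long run.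
  have hN : ∀ δ > 0, ∀ᶠ n in atTop, (N : ℝ) < δ / 2 * selectionCount S ω n := fun δ hδ =>
    (hlim.const_mul_atTop (half_pos hδ)).eventually_gt_atTop _
  refine ⟨fun δ hδ => ?_, fun δ hδ => ?_⟩
  · filter_upwards [(h hlim).1 (δ / 2) (half_pos hδ), hN δ hδ] with n h1 h2
    have := selectedSum_sub_natCast_le (S := S) (ω := ω) (f := fun s => (ψ s).lo)
      (g := fun s => (φ s).lo) (fun s => (ψ s).lo_le_hi.trans (ψ s).le_one)
      (fun s => (φ s).zero_le) (fun s hs => (hsub s hs).1) n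
    linarith
  · filter_upwards [(h hlim).2 (δ / 2) (half_pos hδ), hN δ hδ] with n h1 h2
    have := selectedSum_sub_natCast_le (S := S) (ω := ω) (f := fun s => (φ s).hi)
      (g := fun s => (ψ s).hi) (fun s => (φ s).le_one)
      (fun s => (ψ s).zero_le.trans (ψ s).lo_le_hi) (fun s hs => (hsub s hs).2) n
    linarith

/-- Randomness passes to a stationary forecast that eventually contains the forecasts, provided that
it is not degenerate. -/
theorem IsRandom.stationary_of_eventually_le {R : Notion} {φ : ForecastingSystem} {ω : Path}
    {I : IntervalForecast} {N : ℕ} (hI : I.lo < I.hi)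
    (hsub : ∀ s : Situation, N ≤ s.length → I.lo ≤ (φ s).lo ∧ (φ s).hi ≤ I.hi)
    (h : IsRandom R φ ω) : IsRandom R (stationary I) ω := by
  have hl := I.zero_le
  have hu := I.le_one
  obtain ⟨p, hlp, hpu⟩ := exists_between hI
  have hp : p ∈ I.toSet := ⟨hlp.le, hpu.le⟩
  have hp0 : 0 < p := by linarith
  have hp1 : 0 < 1 - p := by linarith
  obtain ⟨M, hM⟩ := exists_nat_ge (1 / p + 1 / (1 - p))
  have h1 : 0 < 1 / p := by positivity
  have h2 : 0 < 1 / (1 - p) := by positivity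
  have hMp : 1 ≤ M * p := (div_le_iff₀ hp0).1 (by linarith)
  have hMp' : 1 ≤ M * (1 - p) := (div_le_iff₀ hp1).1 (by linarith)
  have hM0 : M ≠ 0 := by rintro rfl; simp at hMp; linarith
  have hW : ∀ s : Situation, M ^ min s.length N ≠ 0 := fun s => pow_ne_zero _ hM0
  have hd : ∀ {T}, IsTestSupermartingale (stationary I) T →
      IsTestSupermartingale φ (damped M N T) := fun hT =>
    hT.damped hp hp0 (by linarith) hMp hMp' fun s hs =>
      Set.Icc_subset_Icc (hsub s hs).1 (hsub s hs).2
  cases R with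
  | ML =>
    exact fun T hT hu => h _ ⟨hd hT.1, hT.2.div_nat (computable_damping M N) hW⟩ (hu.damped hM0 N)
  | wML => exact fun T hT hu => h _ (damped_mem_wmlTests hM0 hT (hd hT.1)) (hu.damped hM0 N)
  | C =>
    exact fun T hT hu => h _ ⟨hd hT.1, hT.2.div_nat (computable_damping M N) hW⟩ (hu.damped hM0 N)
  | S =>
    exact fun T hT hu => h _ ⟨hd hT.1, hT.2.div_nat (computable_damping M N) hW⟩ (hu.damped hM0 N)
  | CH => exact fun S hS => (h S hS).of_eventually_le hsub
  | wCH => exact fun S hS ht => (h S hS ht).of_eventually_le hsub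

/-! ### The smallest interval forecast -/

theorem computableReal_ratCast {D : Type} [Primcodable D] {a : ℚ} (ha : 0 ≤ a) :
    ComputableReal fun _ : D => (a : ℝ) := by
  have h := computableReal_natCast_div (D := D) (Computable.const a.num.toNat)
    (Computable.const a.den) fun _ => a.den_nz
  convert h using 2
  have hnum : ((a.num.toNat : ℤ) : ℝ) = a.num := by
    rw [Int.toNat_of_nonneg (Rat.num_nonneg.2 ha)]
  rw [Int.cast_natCast] at hnum
  rw [hnum, Rat.cast_def]

theorem isComputable_stationary {I : IntervalForecast} {a b : ℚ} (ha : I.lo = a) (hb : I.hi = b) :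
    (stationary I).IsComputable := by
  have ha0 : 0 ≤ a := by exact_mod_cast ha ▸ I.zero_le
  have hb0 : 0 ≤ b := by exact_mod_cast hb ▸ I.zero_le.trans I.lo_le_hi
  simp only [ForecastingSystem.IsComputable, stationary, ha, hb]
  exact ⟨computableReal_ratCast ha0, computableReal_ratCast hb0⟩

theorem tendsto_selectionCount_of_frequently {S : SelectionProcess} {ω : Path}
    (h : ∃ᶠ n in atTop, S (ω.initSeg n) = true) : Tendsto (selectionCount S ω) atTop atTop := by
  have hmono : Monotone (selectionCount S ω) := monotone_nat_of_le_succ fun n => by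
    rw [selectionCount, selectionCount, Finset.sum_range_succ]
    linarith [bit_nonneg (S (ω.initSeg n))]
  refine tendsto_atTop_atTop_of_monotone hmono fun b => ?_
  have key : ∀ m : ℕ, ∃ n, (m : ℝ) ≤ selectionCount S ω n := by
    intro m
    induction m with
    | zero => exact ⟨0, by simp [selectionCount]⟩
    | succ m ih =>
      obtain ⟨n, hn⟩ := ih
      obtain ⟨k, hk, hSk⟩ := (frequently_atTop.1 h) n
      refine ⟨k + 1, ?_⟩
      have := hmono hk
      rw [selectionCount, Finset.sum_range_succ, hSk, ← selectionCount]
      push_cast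
      simp only [bit, if_true]
      linarith
  obtain ⟨m, hm⟩ := exists_nat_ge b
  obtain ⟨n, hn⟩ := key m
  exact ⟨n, hm.trans hn⟩

theorem mul_selectionCount_le_selectedSum_sub {S : SelectionProcess} {f g : Situation → ℝ}
    {ω : Path} {d : ℝ} (h : ∀ s, S s = true → f s + d ≤ g s) (n : ℕ) :
    d * selectionCount S ω n ≤ selectedSum S f ω n - selectedSum S g ω n := by
  rw [selectedSum, selectedSum, selectionCount, Finset.mul_sum, ← Finset.sum_sub_distrib]
  refine Finset.sum_le_sum fun k _ => ?_
  by_cases hk : S (ω.initSeg k) = true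
  · have := h _ hk
    simp only [hk, bit, if_true]
    linarith
  · simp [bit, hk]

/-- No path is weakly Church random for two forecasting systems if a temporal recursive selection
process selects infinitely many situations along the path in which the upper forecast of the one
lies below the lower forecast of the other by a fixed margin. -/
theorem not_isRandom_wCH_of_gap {φ ψ : ForecastingSystem} {ω : Path} {S : SelectionProcess}
    (hS : Computable S) (htemp : S.Temporal) (hfreq : ∃ᶠ n in atTop, S (ω.initSeg n) = true)
    {d : ℝ} (hd : 0 < d) (hgap : ∀ s, S s = true → (φ s).hi + d ≤ (ψ s).lo)
    (hφ : IsRandom .wCH φ ω) (hψ : IsRandom .wCH ψ ω) : False := by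
  have hlim := tendsto_selectionCount_of_frequently hfreq
  have h1 := (frequencyCondition_iff.1 (hφ S hS htemp) hlim).2 (d / 2) (half_pos hd)
  have h2 := (frequencyCondition_iff.1 (hψ S hS htemp) hlim).1 (d / 2) (half_pos hd)
  obtain ⟨n, h1, h2⟩ := (h1.and h2).exists
  have := mul_selectionCount_le_selectedSum_sub (ω := ω) (f := fun s => (φ s).hi)
    (g := fun s => (ψ s).lo) hgap n
  linarith

/-- A selection process that depends on the length of the situation only. -/
def lengthSelection (c : ℕ → Bool) : SelectionProcess := fun s => c s.length

theorem lengthSelection_temporal (c : ℕ → Bool) : (lengthSelection c).Temporal :=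
  fun _ _ h => congrArg c h

/-- For a temporal system, an approximation of a computable forecast that depends on the length of
the situation only. -/
theorem exists_approx_length {φ : ForecastingSystem} (htemp : φ.Temporal)
    {r : IntervalForecast → ℝ} (hr : ComputableReal fun s => r (φ s)) (hr0 : ∀ s, 0 ≤ r (φ s))
    (K : ℕ) : ∃ h : ℕ → ℕ, Computable h ∧
      ∀ s : Situation, r (φ s) * K ≤ h s.length ∧ h s.length ≤ r (φ s) * K + 2 := by
  obtain ⟨a, ha, hak⟩ := hr.exists_approx hr0 K
  let z : Path := fun _ => false
  refine ⟨fun n => a (z.initSeg n), ha.comp (computable_initSeg (Primrec.const false)),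
    fun s => ?_⟩
  rw [htemp s (z.initSeg s.length) (Path.length_initSeg _ _).symm]
  exact hak _

section

variable {φ : ForecastingSystem} {ω : Path}

theorem isBoundedUnder_ge_lo (φ : ForecastingSystem) (ω : Path) :
    IsBoundedUnder (· ≥ ·) atTop fun n => (φ (ω.initSeg n)).lo :=
  isBoundedUnder_of ⟨0, fun _ => (φ _).zero_le⟩

theorem isCoboundedUnder_ge_lo (φ : ForecastingSystem) (ω : Path) :
    IsCoboundedUnder (· ≥ ·) atTop fun n => (φ (ω.initSeg n)).lo :=
  isCoboundedUnder_ge_of_le atTop fun _ => (φ _).lo_le_hi.trans (φ _).le_one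

theorem isBoundedUnder_le_hi (φ : ForecastingSystem) (ω : Path) :
    IsBoundedUnder (· ≤ ·) atTop fun n => (φ (ω.initSeg n)).hi :=
  isBoundedUnder_of ⟨1, fun _ => (φ _).le_one⟩

theorem isCoboundedUnder_le_hi (φ : ForecastingSystem) (ω : Path) :
    IsCoboundedUnder (· ≤ ·) atTop fun n => (φ (ω.initSeg n)).hi :=
  isCoboundedUnder_le_of_le atTop fun _ => (φ _).zero_le.trans (φ _).lo_le_hi

theorem lo_le_liminf {R : Notion} (hcomp : φ.IsComputable) (hprec : φ.Precise)
    (htemp : φ.Temporal) (hω : IsRandom R φ ω) {I : IntervalForecast}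
    (hI : IsRandom R (stationary I) ω) :
    I.lo ≤ liminf (fun n => (φ (ω.initSeg n)).lo) atTop := by
  by_contra! hlt
  obtain ⟨a, ha, haI⟩ := exists_between hlt
  obtain ⟨b, hab, hbI⟩ := exists_rat_btwn haI
  have hfreq := frequently_lt_of_liminf_lt (isCoboundedUnder_ge_lo φ ω) ha
  obtain ⟨n₀, hn₀⟩ := hfreq.exists
  have ha0 : 0 ≤ a := (φ _).zero_le.trans hn₀.le
  have hI1 : I.lo ≤ 1 := I.lo_le_hi.trans I.le_one
  -- Enlarging `I` to `[b, 1]` makes it computable and non-degenerate.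
  let J : IntervalForecast := ⟨b, 1, by linarith, by linarith, le_rfl⟩
  have hJ : IsRandom .wCH (stationary J) ω :=
    (hI.stationary_of_eventually_le (I := J) (N := 0) (show (b : ℝ) < 1 by linarith)
      fun s _ => ⟨hbI.le, I.le_one⟩).wCH
      (isComputable_stationary (a := b) (b := 1) rfl (by simp [J]))
  obtain ⟨K, hK2, hK⟩ := exists_nat_two_div_le (half_pos (sub_pos.2 hab))
  have hK0 : (0 : ℝ) < K := by exact_mod_cast (by omega : 0 < K)
  obtain ⟨h, hh, hhK⟩ := exists_approx_length (r := IntervalForecast.hi) htemp hcomp.2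
    (fun s => (φ s).zero_le.trans (φ s).lo_le_hi) K
  -- An approximation below `a + 2 / K` certifies that the forecast is below `b`, and it occurs
  -- whenever the forecast is below `a`.
  refine not_isRandom_wCH_of_gap (S := lengthSelection fun n => decide (h n < ⌊a * K⌋₊ + 3))
    ((computable_decide_lt hh (Computable.const _)).comp Computable.list_length)
    (lengthSelection_temporal _) (hfreq.mono fun n hn => ?_) (half_pos (sub_pos.2 hab))
    (fun s hs => ?_) (hω.wCH hcomp) hJ
  · have h1 := (hhK (ω.initSeg n)).2
    rw [← hprec] at h1
    have h2 := mul_lt_mul_of_pos_right hn hK0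
    have h3 := Nat.lt_floor_add_one (a * K)
    simp only [lengthSelection, decide_eq_true_eq]
    rify
    linarith
  · have h1 := (hhK s).1
    simp only [lengthSelection, decide_eq_true_eq] at hs
    have hs' : ((h s.length : ℕ) : ℝ) ≤ ⌊a * K⌋₊ + 2 := by exact_mod_cast Nat.lt_succ_iff.1 hs
    have h3 := Nat.floor_le (mul_nonneg ha0 hK0.le)
    rw [div_le_iff₀ hK0] at hK
    change (φ s).hi + (b - a) / 2 ≤ b
    refine le_of_mul_le_mul_right ?_ hK0
    linarith

theorem limsup_le_hi {R : Notion} (hcomp : φ.IsComputable) (hprec : φ.Precise)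
    (htemp : φ.Temporal) (hω : IsRandom R φ ω) {I : IntervalForecast}
    (hI : IsRandom R (stationary I) ω) :
    limsup (fun n => (φ (ω.initSeg n)).hi) atTop ≤ I.hi := by
  by_contra! hlt
  obtain ⟨a, haI, ha⟩ := exists_between hlt
  obtain ⟨b, hbI, hab⟩ := exists_rat_btwn haI
  have hfreq := frequently_lt_of_lt_limsup (isCoboundedUnder_le_hi φ ω) ha
  obtain ⟨n₀, hn₀⟩ := hfreq.exists
  have ha1 : a ≤ 1 := hn₀.le.trans (φ _).le_one
  have hI0 : 0 ≤ I.hi := I.zero_le.trans I.lo_le_hi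
  have ha0 : 0 ≤ a := by linarith
  -- Enlarging `I` to `[0, b]` makes it computable and non-degenerate.
  let J : IntervalForecast := ⟨0, b, le_rfl, by linarith, by linarith⟩
  have hJ : IsRandom .wCH (stationary J) ω :=
    (hI.stationary_of_eventually_le (I := J) (N := 0) (show (0 : ℝ) < b by linarith)
      fun s _ => ⟨I.zero_le, hbI.le⟩).wCH
      (isComputable_stationary (a := 0) (b := b) (by simp [J]) rfl)
  obtain ⟨K, hK2, hK⟩ := exists_nat_two_div_le (half_pos (sub_pos.2 hab))
  have hK0 : (0 : ℝ) < K := by exact_mod_cast (by omega : 0 < K)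
  obtain ⟨h, hh, hhK⟩ := exists_approx_length (r := IntervalForecast.lo) htemp hcomp.1
    (fun s => (φ s).zero_le) K
  refine not_isRandom_wCH_of_gap (S := lengthSelection fun n => decide (⌊a * K⌋₊ < h n))
    ((computable_decide_lt (Computable.const _) hh).comp Computable.list_length)
    (lengthSelection_temporal _) (hfreq.mono fun n hn => ?_) (half_pos (sub_pos.2 hab))
    (fun s hs => ?_) hJ (hω.wCH hcomp)
  · have h1 := (hhK (ω.initSeg n)).1
    rw [hprec] at h1
    have h2 := mul_lt_mul_of_pos_right hn hK0
    have h3 := Nat.floor_le (mul_nonneg ha0 hK0.le)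
    simp only [lengthSelection, decide_eq_true_eq]
    rify
    linarith
  · have h1 := (hhK s).2
    simp only [lengthSelection, decide_eq_true_eq] at hs
    have hs' : ((⌊a * K⌋₊ : ℕ) : ℝ) + 1 ≤ h s.length := by exact_mod_cast hs
    have h3 := Nat.lt_floor_add_one (a * K)
    rw [div_le_iff₀ hK0] at hK
    change b + (a - b) / 2 ≤ (φ s).lo
    refine le_of_mul_le_mul_right ?_ hK0
    linarith

theorem limitForecast_subset_smallestForecast {R : Notion} (hcomp : φ.IsComputable)
    (hprec : φ.Precise) (htemp : φ.Temporal) (hω : IsRandom R φ ω) :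
    limitForecast φ ω ⊆ smallestForecast R ω :=
  Set.subset_iInter₂ fun _ hI =>
    Set.Icc_subset_Icc (lo_le_liminf hcomp hprec htemp hω hI)
      (limsup_le_hi hcomp hprec htemp hω hI)

/-- Along a temporal system, a property of the forecasts that eventually holds on one path
eventually holds in all situations. -/
theorem ForecastingSystem.Temporal.exists_forall_length (htemp : φ.Temporal)
    {P : IntervalForecast → Prop} (h : ∀ᶠ n in atTop, P (φ (ω.initSeg n))) :
    ∃ N, ∀ s : Situation, N ≤ s.length → P (φ s) := by
  obtain ⟨N, hN⟩ := eventually_atTop.1 h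
  refine ⟨N, fun s hs => ?_⟩
  rw [htemp s (ω.initSeg s.length) (Path.length_initSeg _ _).symm]
  exact hN _ hs

theorem smallestForecast_subset_limitForecast {R : Notion} (htemp : φ.Temporal)
    (hω : IsRandom R φ ω) : smallestForecast R ω ⊆ limitForecast φ ω := by
  intro x hx
  have hmem : ∀ I : IntervalForecast, IsRandom R (stationary I) ω → x ∈ I.toSet :=
    Set.mem_iInter₂.1 hx
  refine ⟨le_of_forall_lt fun a ha => ?_, le_of_forall_gt fun b hb => ?_⟩
  · obtain ⟨c, hac, hc⟩ := exists_between ha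
    have hev := eventually_lt_of_lt_liminf hc (isBoundedUnder_ge_lo φ ω)
    obtain ⟨N, hN⟩ := htemp.exists_forall_length (P := fun I => c < I.lo) hev
    obtain ⟨n₀, hn₀⟩ := hev.exists
    have hc1 : c < 1 := hn₀.trans_le ((φ _).lo_le_hi.trans (φ _).le_one)
    let J : IntervalForecast := ⟨max c 0, 1, le_max_right _ _, max_le hc1.le zero_le_one, le_rfl⟩
    have hJ := hmem J (hω.stationary_of_eventually_le (N := N) (max_lt hc1 one_pos)
      fun s hs => ⟨max_le (hN s hs).le (φ s).zero_le, (φ s).le_one⟩)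
    exact hac.trans_le ((le_max_left c 0).trans hJ.1)
  · obtain ⟨c, hc, hcb⟩ := exists_between hb
    have hev := eventually_lt_of_limsup_lt hc (isBoundedUnder_le_hi φ ω)
    obtain ⟨N, hN⟩ := htemp.exists_forall_length (P := fun I => I.hi < c) hev
    obtain ⟨n₀, hn₀⟩ := hev.exists
    have hc0 : 0 < c := ((φ _).zero_le.trans (φ _).lo_le_hi).trans_lt hn₀
    let J : IntervalForecast := ⟨0, min c 1, le_rfl, le_min hc0.le zero_le_one, min_le_right _ _⟩
    have hJ := hmem J (hω.stationary_of_eventually_le (N := N) (lt_min hc0 one_pos)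
      fun s hs => ⟨(φ s).zero_le, le_min (hN s hs).le (φ s).le_one⟩)
    exact (hJ.2.trans (min_le_left c 1)).trans_lt hcb

theorem smallestForecast_eq_limitForecast {R : Notion} (hcomp : φ.IsComputable)
    (hprec : φ.Precise) (htemp : φ.Temporal) (hω : IsRandom R φ ω) :
    smallestForecast R ω = limitForecast φ ω :=
  (smallestForecast_subset_limitForecast htemp hω).antisymm
    (limitForecast_subset_smallestForecast hcomp hprec htemp hω)

end

end ImpreciseRandomness

theorem mainTheorem2 (R : ImpreciseRandomness.Notion)
    (φ : ImpreciseRandomness.ForecastingSystem) (ω : ImpreciseRandomness.Path)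
    (hcomp : ImpreciseRandomness.ForecastingSystem.IsComputable φ)
    (hprec : ImpreciseRandomness.ForecastingSystem.Precise φ)
    (htemp : ImpreciseRandomness.ForecastingSystem.Temporal φ)
    (hω : ImpreciseRandomness.IsRandom R φ ω) :
    ImpreciseRandomness.smallestForecast R ω = ImpreciseRandomness.limitForecast φ ω ∧
      ImpreciseRandomness.smallestForecast .wCH ω =
        ImpreciseRandomness.limitForecast φ ω :=
  ⟨ImpreciseRandomness.smallestForecast_eq_limitForecast hcomp hprec htemp hω,
    ImpreciseRandomness.smallestForecast_eq_limitForecast hcomp hprec htemp (hω.wCH hcomp)⟩
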